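/- Let $G$ be a Hausdorff topological group with identity element $e$, and let $\mathscr{U}_e(G)$ denote the set of all neighbourhoods of $e$ in $G$. Let $\mathrm{RUC}_b(G)$ be the real vector space of all bounded functions $f\colon G\to\mathbb{R}$ that are uniformly continuous with respect to the right uniformity, i.e., such that for every $\varepsilon>0$ there is $U\in\mathscr{U}_e(G)$ with $|f(x)-f(y)|<\varepsilon$ whenever $xy^{-1}\in U$. The topological group $G$ is called amenable if there is a positive linear map $\mu\colon\mathrm{RUC}_b(G)\to\mathbb{R}$ with $\mu(\mathbf 1)=1$ and $\mu(x\mapsto f(gx))=\mu(f)$ for all $f\in\mathrm{RUC}_b(G)$ and $g\in G$. An action of a group $\Gamma$ on a non-empty set $X$ is called amenable if there is a positive linear map $\mu\colon\ell^\infty(X)\to\mathbb{R}$ on the space of all bounded real-valued functions on $X$ with $\mu(\mathbf 1)=1$ and $\mu(x\mapsto f(\gamma x))=\mu(f)$ for all $f\in\ell^\infty(X)$ and $\gamma\in\Gamma$. For $U\in\mathscr{U}_e(G)$ let $\mathscr{N}_G(U)$ be the set of all maps $\alpha\colon G\to\mathrm{Sym}(G)$ such that $\alpha(g)(h)\in Ugh$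 for all $g,h\in G$. For $\alpha\in\mathscr{N}_G(U)$ let $\Gamma(\alpha)\leq\mathrm{Sym}(G)$ be the subgroup generated by $\{\alpha(g)\mid g\in G\}$. Let $\Gamma_U(G)\leq\mathrm{Sym}(G\times\mathscr{N}_G(U))$ be the subgroup generated by the permutations $(h,\alpha)\mapsto(\alpha(g)(h),\alpha)$ of $G\times\mathscr{N}_G(U)$, where $g\in G$. The following are equivalent: 1. $G$ is amenable. 2. For every $U\in\mathscr{U}_e(G)$ there exists $\alpha\in\mathscr{N}_G(U)$ such that the action of $\Gamma(\alpha)$ on the set $G$ is amenable. 3. For every $U\in\mathscr{U}_e(G)$ the action of $\Gamma_U(G)$ on the set $G\times\mathscr{N}_G(U)$ is amenable. -/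

import Mathlib

open scoped Topology

/-- The space `ℓ^∞(X)` of all bounded real-valued functions on the set `X`. -/
def ellInfty (X : Type*) : Submodule ℝ (X → ℝ) where
  carrier := {f | ∃ C : ℝ, ∀ x, |f x| ≤ C}
  zero_mem' := ⟨0, fun x => by simp⟩
  add_mem' := by
    rintro f g ⟨C, hC⟩ ⟨D, hD⟩
    exact ⟨C + D, fun x => (abs_add_le (f x) (g x)).trans (add_le_add (hC x) (hD x))⟩
  smul_mem' := by
    rintro c f ⟨C, hC⟩
    refine ⟨|c| * C, fun x => ?_⟩
    rw [Pi.smul_apply, smul_eq_mul, abs_mul]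
    exact mul_le_mul_of_nonneg_left (hC x) (abs_nonneg c)

theorem one_mem_ellInfty (X : Type*) : (1 : X → ℝ) ∈ ellInfty X :=
  ⟨1, fun x => by simp⟩

theorem comp_mem_ellInfty {X : Type*} {f : X → ℝ} (hf : f ∈ ellInfty X) (t : X → X) :
    f ∘ t ∈ ellInfty X := by
  obtain ⟨C, hC⟩ := hf
  exact ⟨C, fun x => hC (t x)⟩

/-- An action of a group `Γ` on a set `X` is amenable if `ℓ^∞(X)` admits a `Γ`-invariant mean.
(The condition `μ 1 = 1` forces `X` to be non-empty.) -/
def IsAmenableAction (Γ X : Type*) [Group Γ] [MulAction Γ X] : Prop :=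
  ∃ μ : ellInfty X →ₗ[ℝ] ℝ,
    (∀ f : ellInfty X, (∀ x, 0 ≤ f.1 x) → 0 ≤ μ f) ∧
    μ ⟨1, one_mem_ellInfty X⟩ = 1 ∧
    ∀ (γ : Γ) (f : ellInfty X),
      μ ⟨f.1 ∘ fun x => γ • x, comp_mem_ellInfty f.2 _⟩ = μ f

section TopologicalGroup

variable (G : Type*) [Group G] [TopologicalSpace G] [IsTopologicalGroup G]

/-- The space `RUC_b(G)` of all bounded real-valued functions on the topological group `G` that are
uniformly continuous with respect to the right uniformity of `G`, whose entourages are the sets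
containing `{(x, y) | x * y⁻¹ ∈ U}` for some identity neighbourhood `U`. -/
def RUCb : Submodule ℝ (G → ℝ) where
  carrier := {f | f ∈ ellInfty G ∧
    @UniformContinuous G ℝ (IsTopologicalGroup.rightUniformSpace G) inferInstance f}
  zero_mem' := by
    letI := IsTopologicalGroup.rightUniformSpace G
    exact ⟨(ellInfty G).zero_mem, uniformContinuous_const⟩
  add_mem' := by
    letI := IsTopologicalGroup.rightUniformSpace G
    rintro f g ⟨hf, hf'⟩ ⟨hg, hg'⟩
    exact ⟨(ellInfty G).add_mem hf hg, UniformContinuous.add hf' hg'⟩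
  smul_mem' := by
    letI := IsTopologicalGroup.rightUniformSpace G
    rintro c f ⟨hf, hf'⟩
    exact ⟨(ellInfty G).smul_mem c hf, UniformContinuous.const_smul hf' c⟩

theorem one_mem_RUCb : (1 : G → ℝ) ∈ RUCb G := by
  letI := IsTopologicalGroup.rightUniformSpace G
  exact ⟨one_mem_ellInfty G, uniformContinuous_const⟩

variable {G} in
theorem comp_mul_left_mem_RUCb {f : G → ℝ} (hf : f ∈ RUCb G) (g : G) :
    (f ∘ fun x => g * x) ∈ RUCb G := by
  letI := IsTopologicalGroup.rightUniformSpace G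
  refine ⟨comp_mem_ellInfty hf.1 _, UniformContinuous.comp hf.2 ?_⟩
  have hc : Filter.Tendsto (fun z : G => g * z * g⁻¹) (𝓝 1) (𝓝 1) := by
    have h : Continuous fun z : G => g * z * g⁻¹ := by fun_prop
    simpa using h.tendsto 1
  rw [UniformContinuous, uniformity_eq_comap_nhds_one', Filter.tendsto_comap_iff]
  refine (hc.comp Filter.tendsto_comap).congr fun p => ?_
  simp [Function.comp_def, div_eq_mul_inv, mul_assoc]

/-- A topological group `G` is amenable if `RUC_b(G)` admits a left-invariant mean. -/
def IsAmenableTopGroup : Prop :=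
  ∃ μ : RUCb G →ₗ[ℝ] ℝ,
    (∀ f : RUCb G, (∀ x, 0 ≤ f.1 x) → 0 ≤ μ f) ∧
    μ ⟨1, one_mem_RUCb G⟩ = 1 ∧
    ∀ (g : G) (f : RUCb G),
      μ ⟨f.1 ∘ fun x => g * x, comp_mul_left_mem_RUCb f.2 g⟩ = μ f

end TopologicalGroup

/-- `Γ(α)`: the subgroup of `Sym(X)` generated by the permutations `α i`, `i ∈ I`. -/
def generatedGroup {I X : Type*} (α : I → Equiv.Perm X) : Subgroup (Equiv.Perm X) :=
  Subgroup.closure (Set.range α)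

/-- The direct sum of a family of maps `α j : I → Sym(X)`, `j ∈ J`: the map `I → Sym(X × J)` with
`(directSumPerm α i) (x, j) = (α j i x, j)`. -/
def directSumPerm {I J X : Type*} (α : J → I → Equiv.Perm X) : I → Equiv.Perm (X × J) :=
  fun i => Equiv.prodCongrLeft fun j => α j i

theorem directSumPerm_apply {I J X : Type*} (α : J → I → Equiv.Perm X) (i : I) (x : X) (j : J) :
    directSumPerm α i (x, j) = (α j i x, j) := rfl

/-- `N_G(U)`: the set of all maps `α : G → Sym(G)` with `α(g)(h) ∈ U g h` for all `g, h ∈ G`. -/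
def perturbations {G : Type*} [Group G] (U : Set G) : Set (G → Equiv.Perm G) :=
  {α | ∀ g h : G, ∃ u ∈ U, α g h = u * (g * h)}

/-- `Γ_U(G)`: the subgroup of `Sym(G × N_G(U))` generated by the image of the direct sum of all
members of `N_G(U)`. -/
def perturbationGroup {G : Type*} [Group G] (U : Set G) :
    Subgroup (Equiv.Perm (G × (perturbations U : Set (G → Equiv.Perm G)))) :=
  generatedGroup (directSumPerm fun α : (perturbations U : Set (G → Equiv.Perm G)) => α.1)

/-! From 3 to 1 (`isAmenableTopGroup_of_perturbationGroup`): for `f` in `RUCb G`, the values `f (g *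
x)` and `f (α g x)` are uniformly close when `U` is small. Invariant means on the sets `G ×
perturbations U`, pushed to `G`, are therefore almost left-invariant on `RUCb G`, and an ultrafilter
limit as `U` shrinks is exactly invariant. From 2 to 3, a mean is carried by one slice `G × {α}`.

The substance is 1 to 2. In a discrete group every bounded function is in `RUCb G`, and left
translations themselves serve as `α`. Otherwise a topological Følner condition is needed.
Hahn–Banach and rounding turn the mean into a finite family `y` that is almost invariant when tested
against Lipschitz bumps of all subsets at once (`IsAmenableTopGroup.exists_norm_sum_lt`). This is
Hall's condition with small deficiency, so most `g * y i` are matched injectively with points `y j`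
in `U * g * y i` (`IsAmenableTopGroup.exists_matching`). As neighbourhoods of `1` are infinite, the
points can be moved slightly into general position, giving genuine finite sets
(`IsAmenableTopGroup.exists_isFolnerSet`).

Right translation preserves the Følner property, so such sets for all pairs (finite `E`, `1 / (n +
1)`) can be made disjoint inside `G`. A single permutation per `g` then realises all the matchings
(`exists_perturbed_translation`), and averages over these sets converge along an ultrafilter to the
invariant mean. -/

open Filter

/-! ### Means: limits, push-forwards, invariance under generators -/

/-- A mean on a space `V` of functions: a positive linear functional, normalised at `1`. -/
structure IsMean {X : Type*} {V : Submodule ℝ (X → ℝ)} (μ : V →ₗ[ℝ] ℝ) : Prop where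
  nonneg : ∀ f : V, (∀ x, 0 ≤ f.1 x) → 0 ≤ μ f
  map_one : ∀ h : (1 : X → ℝ) ∈ V, μ ⟨1, h⟩ = 1

theorem IsMean.abs_map_le {X : Type*} {V : Submodule ℝ (X → ℝ)} {μ : V →ₗ[ℝ] ℝ} (hμ : IsMean μ)
    (h1 : (1 : X → ℝ) ∈ V) {f : V} {C : ℝ} (hf : ∀ x, |f.1 x| ≤ C) : |μ f| ≤ C := by
  have h₁ := hμ.nonneg (C • ⟨1, h1⟩ - f) fun x => by
    have := (abs_le.1 (hf x)).2
    simpa using this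
  have h₂ := hμ.nonneg (C • ⟨1, h1⟩ + f) fun x => by
    have := (abs_le.1 (hf x)).1
    simp only [Submodule.coe_add, Submodule.coe_smul, Pi.add_apply, Pi.smul_apply, Pi.one_apply,
      smul_eq_mul]
    linarith
  rw [map_sub, map_smul, hμ.map_one, smul_eq_mul] at h₁
  rw [map_add, map_smul, hμ.map_one, smul_eq_mul] at h₂
  rw [abs_le]
  constructor <;> linarith

/-- Limits of means along an ultrafilter. -/
theorem exists_limit_mean {X I : Type*} {V : Submodule ℝ (X → ℝ)} (hV : V ≤ ellInfty X)
    (h1 : (1 : X → ℝ) ∈ V) (l : Filter I) [l.NeBot] (m : I → V →ₗ[ℝ] ℝ)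
    (hm : ∀ i, IsMean (m i)) :
    ∃ μ : V →ₗ[ℝ] ℝ, IsMean μ ∧
      ∀ f f' : V, Tendsto (fun i => m i f - m i f') l (𝓝 0) → μ f = μ f' := by
  have hlim : ∀ f : V, ∃ a : ℝ, Tendsto (fun i => m i f) (Ultrafilter.of l : Filter I) (𝓝 a) := by
    intro f
    obtain ⟨C, hC⟩ := hV f.2
    obtain ⟨a, -, ha⟩ := (isCompact_Icc (a := -C) (b := C)).ultrafilter_le_nhds
      ((Ultrafilter.of l).map fun i => m i f) (by
        rw [le_principal_iff]
        exact mem_map.2 (univ_mem' fun i => abs_le.1 ((hm i).abs_map_le h1 hC)))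
    exact ⟨a, ha⟩
  choose a ha using hlim
  refine ⟨{ toFun := a, map_add' := fun f g => ?_, map_smul' := fun c f => ?_ }, ⟨fun f hf => ?_,
    fun h => ?_⟩, fun f f' h => ?_⟩
  · exact tendsto_nhds_unique (ha _) (by simpa using (ha f).add (ha g))
  · exact tendsto_nhds_unique (ha _) (by simpa using (ha f).const_mul c)
  · exact ge_of_tendsto' (ha f) fun i => (hm i).nonneg f hf
  · exact tendsto_nhds_unique (ha _)
      (tendsto_const_nhds.congr fun i => ((hm i).map_one h).symm)
  · exact sub_eq_zero.1 (tendsto_nhds_unique ((ha f).sub (ha f'))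
      (h.mono_left (Ultrafilter.of_le l)))

/-- The permutations that preserve a given mean form a subgroup, so generators suffice. -/
theorem isAmenableAction_generatedGroup {I X : Type*} {α : I → Equiv.Perm X}
    {μ : ellInfty X →ₗ[ℝ] ℝ} (hμ : IsMean μ)
    (h : ∀ (i : I) (f : ellInfty X), μ ⟨f.1 ∘ α i, comp_mem_ellInfty f.2 _⟩ = μ f) :
    IsAmenableAction (generatedGroup α) X := by
  refine ⟨μ, hμ.nonneg, hμ.map_one _, fun γ f => ?_⟩
  obtain ⟨γ, hγ⟩ := γ
  have key : ∀ f : ellInfty X, μ ⟨f.1 ∘ γ, comp_mem_ellInfty f.2 _⟩ = μ f := by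
    induction hγ using Subgroup.closure_induction with
    | mem x hx =>
      obtain ⟨i, rfl⟩ := hx
      exact h i
    | one => exact fun f => rfl
    | mul x y _ _ hx hy =>
      intro f
      rw [← hx f, ← hy ⟨f.1 ∘ x, comp_mem_ellInfty f.2 _⟩]
      rfl
    | inv x _ hx =>
      intro f
      rw [← hx]
      congr 2
      ext z
      simp
  exact key f

theorem comp_mem_ellInfty_of_mem {X Y : Type*} {f : Y → ℝ} (hf : f ∈ ellInfty Y) (t : X → Y) :
    f ∘ t ∈ ellInfty X := by
  obtain ⟨C, hC⟩ := hf
  exact ⟨C, fun x => hC (t x)⟩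

/-- Pushing a mean forward along a map. -/
def pushMean {X Y : Type*} (t : X → Y) (μ : ellInfty X →ₗ[ℝ] ℝ) : ellInfty Y →ₗ[ℝ] ℝ where
  toFun f := μ ⟨f.1 ∘ t, comp_mem_ellInfty_of_mem f.2 t⟩
  map_add' f g := by rw [← map_add]; rfl
  map_smul' c f := by rw [← map_smul]; rfl

theorem isMean_pushMean {X Y : Type*} (t : X → Y) {μ : ellInfty X →ₗ[ℝ] ℝ} (hμ : IsMean μ) :
    IsMean (pushMean t μ) where
  nonneg _ hf := hμ.nonneg _ fun x => hf (t x)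
  map_one _ := hμ.map_one _

theorem mem_generatedGroup {I X : Type*} (α : I → Equiv.Perm X) (i : I) :
    α i ∈ generatedGroup α :=
  Subgroup.subset_closure ⟨i, rfl⟩

theorem IsAmenableAction.exists_mean {I X : Type*} {α : I → Equiv.Perm X}
    (h : IsAmenableAction (generatedGroup α) X) :
    ∃ μ : ellInfty X →ₗ[ℝ] ℝ, IsMean μ ∧
      ∀ (i : I) (f : ellInfty X), μ ⟨f.1 ∘ α i, comp_mem_ellInfty f.2 _⟩ = μ f := by
  obtain ⟨μ, h₀, h₁, h₂⟩ := h
  exact ⟨μ, ⟨h₀, fun _ => h₁⟩, fun i f => h₂ ⟨α i, mem_generatedGroup α i⟩ f⟩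

theorem isAmenableAction_directSumPerm {I J X : Type*} (α : J → I → Equiv.Perm X) (j : J)
    (h : IsAmenableAction (generatedGroup (α j)) X) :
    IsAmenableAction (generatedGroup (directSumPerm α)) (X × J) := by
  obtain ⟨μ, hμ, hinv⟩ := h.exists_mean
  refine isAmenableAction_generatedGroup (isMean_pushMean (fun x => (x, j)) hμ) fun i f => ?_
  exact hinv i ⟨f.1 ∘ fun x => (x, j), comp_mem_ellInfty_of_mem f.2 _⟩

/-! ### Means on `RUCb G`: from perturbations to amenability, and the discrete case -/

section TopologicalGroup

variable {G : Type*} [Group G] [TopologicalSpace G] [IsTopologicalGroup G]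

theorem mem_RUCb_iff {f : G → ℝ} : f ∈ RUCb G ↔ f ∈ ellInfty G ∧
    ∀ ε > 0, ∃ U ∈ 𝓝 (1 : G), ∀ x y, y * x⁻¹ ∈ U → |f y - f x| < ε := by
  let _ := IsTopologicalGroup.rightUniformSpace G
  refine and_congr_right fun _ => ?_
  rw [UniformContinuous, uniformity_eq_comap_nhds_one',
    ((𝓝 (1 : G)).basis_sets.comap _).tendsto_iff Metric.uniformity_basis_dist]
  simp only [Set.mem_preimage, Prod.forall, Set.mem_ofPred_eq, id, Real.dist_eq]
  simp only [abs_sub_comm]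

variable (G) in
theorem RUCb_le_ellInfty : RUCb G ≤ ellInfty G := fun _ hf => (mem_RUCb_iff.1 hf).1

theorem isAmenableTopGroup_of_perturbationGroup
    (h : ∀ U ∈ 𝓝 (1 : G), IsAmenableAction (perturbationGroup U) (G × perturbations U)) :
    IsAmenableTopGroup G := by
  choose ν hν hinv using fun (U : (𝓝 (1 : G)).sets) => (h U.1 U.2).exists_mean
  let m : (𝓝 (1 : G)).sets → RUCb G →ₗ[ℝ] ℝ := fun U =>
    (pushMean Prod.fst (ν U)).comp (Submodule.inclusion (RUCb_le_ellInfty G))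
  have hm : ∀ U, IsMean (m U) := fun U =>
    ⟨fun f hf => (isMean_pushMean _ (hν U)).nonneg _ hf, fun _ => (hν U).map_one _⟩
  -- The filter of identity neighbourhoods shrinking to `1`.
  let l : Filter (𝓝 (1 : G)).sets := comap Subtype.val (𝓝 (1 : G)).smallSets
  have hl : l.NeBot := by
    refine comap_neBot_iff.2 fun t ht => ?_
    obtain ⟨s, hs, hst⟩ := (hasBasis_smallSets _).mem_iff.1 ht
    exact ⟨⟨s, hs⟩, hst (Set.Subset.refl s)⟩
  obtain ⟨μ, hμ, hlim⟩ := exists_limit_mean (RUCb_le_ellInfty G) (one_mem_RUCb G) l m hm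
  refine ⟨μ, hμ.nonneg, hμ.map_one _, fun g f => hlim _ _ ?_⟩
  rw [Metric.tendsto_nhds]
  intro ε hε
  obtain ⟨V, hV, hVf⟩ := (mem_RUCb_iff.1 f.2).2 (ε / 2) (half_pos hε)
  have hev : ∀ᶠ U : (𝓝 (1 : G)).sets in l, U.1 ⊆ V :=
    (eventually_smallSets.2 ⟨V, hV, fun t ht => ht⟩ :
      ∀ᶠ U in (𝓝 (1 : G)).smallSets, U ⊆ V).comap _
  filter_upwards [hev] with U hU
  rw [Real.dist_eq, sub_zero]
  let F : ellInfty (G × perturbations U.1) := ⟨f.1 ∘ Prod.fst, comp_mem_ellInfty_of_mem f.2.1 _⟩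
  let F' : ellInfty (G × perturbations U.1) :=
    ⟨(f.1 ∘ fun x => g * x) ∘ Prod.fst, comp_mem_ellInfty_of_mem (comp_mem_ellInfty f.2.1 _) _⟩
  have hF := hinv U g F
  -- Invariance of `ν U` replaces `f` by `f (α g x)`; what remains is the mean of a function that is
  -- uniformly small because `α g x ∈ U * g * x`.
  have hdiff : m U ⟨f.1 ∘ fun x => g * x, comp_mul_left_mem_RUCb f.2 g⟩ - m U f
      = ν U (F' - ⟨F.1 ∘ directSumPerm (fun α : perturbations U.1 => α.1) g,
          comp_mem_ellInfty F.2 _⟩) := by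
    rw [map_sub, hF]
    rfl
  rw [hdiff]
  refine lt_of_le_of_lt ((hν U).abs_map_le (one_mem_ellInfty _) (C := ε / 2) ?_) (half_lt_self hε)
  rintro ⟨x, α⟩
  obtain ⟨u, hu, hux⟩ := α.2 g x
  refine le_of_lt ?_
  change |f.1 (g * x) - f.1 (α.1 g x)| < ε / 2
  rw [abs_sub_comm]
  refine hVf (g * x) (α.1 g x) ?_
  rw [hux, mul_inv_cancel_right]
  exact hU hu

theorem isAmenableAction_mulLeft_of_discrete (h1 : {1} ∈ 𝓝 (1 : G)) (h : IsAmenableTopGroup G) :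
    IsAmenableAction (generatedGroup fun g : G => Equiv.mulLeft g) G := by
  obtain ⟨μ, h₀, h₁, h₂⟩ := h
  have hle : ellInfty G ≤ RUCb G := fun f hf =>
    mem_RUCb_iff.2 ⟨hf, fun ε hε => ⟨{1}, h1, fun x y hxy => by
      obtain rfl : y = x := mul_inv_eq_one.1 hxy
      simpa using hε⟩⟩
  refine isAmenableAction_generatedGroup (μ := μ.comp (Submodule.inclusion hle))
    ⟨fun f hf => h₀ _ hf, fun _ => h₁⟩ fun g f => h₂ g ⟨f.1, hle f.2⟩

end TopologicalGroup

/-! ### Tools: pseudometrics, rounding of convex combinations, Hall's theorem -/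

open scoped Uniformity in
/-- Every entourage of a uniform space is an entourage of a uniformly continuous pseudometric. -/
theorem exists_pseudoMetricSpace_of_mem_uniformity {X : Type*} [u : UniformSpace X]
    {V : Set (X × X)} (hV : V ∈ 𝓤 X) :
    ∃ d : PseudoMetricSpace X, u ≤ d.toUniformSpace ∧ V ∈ 𝓤[d.toUniformSpace] := by
  have hstep : ∀ s : {s : Set (X × X) // s ∈ 𝓤 X}, ∃ t : {t : Set (X × X) // t ∈ 𝓤 X},
      (∀ x y, (x, y) ∈ t.1 → (y, x) ∈ t.1) ∧
        ∀ x y z, (x, y) ∈ t.1 → (y, z) ∈ t.1 → (x, z) ∈ s.1 := by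
    rintro ⟨s, hs⟩
    obtain ⟨t, ht, hsymm, hcomp⟩ := comp_symm_mem_uniformity_sets hs
    exact ⟨⟨t, ht⟩, fun x y h => hsymm.symm _ _ h, fun x y z hxy hyz => hcomp ⟨y, hxy, hyz⟩⟩
  choose next hsymm hcomp using hstep
  -- Symmetric entourages with `W (n + 1) ∘ W (n + 1) ⊆ W n`, starting below `V`: they generate a
  -- coarser uniformity with a countable base, hence a pseudometrizable one.
  let W : ℕ → {s : Set (X × X) // s ∈ 𝓤 X} := fun n => n.rec (next ⟨V, hV⟩) fun _ s => next s
  have hW : ∀ n x y z, (x, y) ∈ (W (n + 1)).1 → (y, z) ∈ (W (n + 1)).1 → (x, z) ∈ (W n).1 :=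
    fun n => hcomp (W n)
  have hWs : ∀ n x y, (x, y) ∈ (W n).1 → (y, x) ∈ (W n).1 := by
    rintro (_ | n)
    · exact hsymm _
    · exact hsymm _
  have hrefl : ∀ n x, (x, x) ∈ (W n).1 := fun n x => refl_mem_uniformity (W n).2
  have hanti : Antitone fun n => (W n).1 :=
    antitone_nat_of_succ_le fun n p hp => hW n p.1 p.2 p.2 hp (hrefl (n + 1) _)
  have hbasis := HasAntitoneBasis.iInf_principal hanti
  let c : UniformSpace.Core X := UniformSpace.Core.mk (⨅ n, 𝓟 (W n).1)
    (le_iInf fun n => principal_mono.2 fun p hp => by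
      obtain ⟨x, y⟩ := p
      obtain rfl : x = y := hp
      exact hrefl n x)
    (hbasis.1.tendsto_iff hbasis.1 |>.2 fun n _ => ⟨n, trivial, fun p hp => hWs n _ _ hp⟩)
    (le_iInf fun n => le_principal_iff.2 <| mem_of_superset
      (mem_lift' (hbasis.1.mem_of_mem (i := n + 1) trivial)) <| by
        rintro ⟨x, z⟩ ⟨y, hxy, hyz⟩
        exact hW n x y z hxy hyz)
  let u' : UniformSpace X := UniformSpace.ofCore c
  have hcount : IsCountablyGenerated (𝓤[u']) := hbasis.isCountablyGenerated
  refine ⟨@UniformSpace.pseudoMetricSpace X u' hcount, ?_, ?_⟩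
  · exact le_iInf fun n => le_principal_iff.2 (W n).2
  · refine mem_of_superset (hbasis.1.mem_of_mem (i := 0) trivial) fun p hp => ?_
    exact hcomp ⟨V, hV⟩ p.1 p.2 p.2 hp (hrefl 0 _)

/-- A real convex combination can be approximated by an average with equal weights. -/
theorem exists_norm_sum_lt_of_mem_convexHull {X B : Type*} [NormedAddCommGroup B] [NormedSpace ℝ B]
    {T : X → B} {c : B} (hc : c ∈ convexHull ℝ (Set.range T)) {ε : ℝ} (hcε : ‖c‖ < ε) :
    ∃ (ι : Type) (_ : Fintype ι) (y : ι → X), ‖∑ i, T (y i)‖ < ε * Fintype.card ι := by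
  obtain ⟨κ, _, w, z, hw, hw1, hz, rfl⟩ := mem_convexHull_iff_exists_fintype.1 hc
  choose x hx using hz
  -- Point `j` is repeated `⌊w j * N⌋₊` times; for large `N` the proportions approach the weights.
  have hk : ∀ j, Tendsto (fun N : ℝ => (⌊w j * N⌋₊ : ℝ) / N) atTop (nhds (w j)) :=
    fun j => tendsto_nat_floor_mul_div_atTop (hw j)
  have h₁ : Tendsto (fun N : ℝ => ‖∑ j, ((⌊w j * N⌋₊ : ℝ) / N) • z j‖) atTop
      (nhds ‖∑ j, w j • z j‖) :=
    (tendsto_finsetSum _ fun j _ => (hk j).smul_const (z j)).norm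
  have h₂ : Tendsto (fun N : ℝ => ε * ∑ j, (⌊w j * N⌋₊ : ℝ) / N) atTop (nhds ε) := by
    simpa [hw1] using (tendsto_finsetSum Finset.univ fun j _ => hk j).const_mul ε
  obtain ⟨N, hN, hN0⟩ := ((h₁.eventually_lt h₂ hcε).and (eventually_gt_atTop 0)).exists
  let e := Fintype.equivFin κ
  refine ⟨Σ j : Fin (Fintype.card κ), Fin ⌊w (e.symm j) * N⌋₊, inferInstance,
    fun p => x (e.symm p.1), ?_⟩
  have h₃ : ∑ p : Σ j : Fin (Fintype.card κ), Fin ⌊w (e.symm j) * N⌋₊, T (x (e.symm p.1))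
      = N • ∑ j, ((⌊w j * N⌋₊ : ℝ) / N) • z j := by
    rw [Fintype.sum_sigma, Finset.smul_sum, ← e.symm.sum_comp]
    refine Finset.sum_congr rfl fun j _ => ?_
    rw [smul_smul, mul_div_cancel₀ _ hN0.ne']
    simp [hx, Nat.cast_smul_eq_nsmul]
  have h₄ : (Fintype.card (Σ j : Fin (Fintype.card κ), Fin ⌊w (e.symm j) * N⌋₊) : ℝ)
      = N * ∑ j, (⌊w j * N⌋₊ : ℝ) / N := by
    rw [Fintype.card_sigma, Finset.mul_sum, ← e.symm.sum_comp]
    push_cast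
    refine Finset.sum_congr rfl fun j _ => ?_
    rw [mul_div_cancel₀ _ hN0.ne', Fintype.card_fin]
  rw [h₃, h₄, norm_smul, Real.norm_of_nonneg hN0.le, mul_left_comm]
  exact mul_lt_mul_of_pos_left hN hN0

/-- Hall's theorem with deficiency `d`. -/
theorem exists_partial_matching {ι : Type*} [Fintype ι] [DecidableEq ι] (t : ι → Finset ι) (d : ℕ)
    (h : ∀ s : Finset ι, s.card ≤ (s.biUnion t).card + d) :
    ∃ (S : Finset ι) (m : ι → ι), Set.InjOn m S ∧ (∀ i ∈ S, m i ∈ t i) ∧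
      Fintype.card ι ≤ S.card + d := by
  -- With `d` dummy partners acceptable to everyone, Hall's condition holds exactly; at most `d`
  -- indices receive a dummy.
  obtain ⟨f, hf, hft⟩ := (Finset.all_card_le_biUnion_card_iff_exists_injective
    fun i => (t i).disjSum (Finset.univ : Finset (Fin d))).1 fun s => by
      rcases s.eq_empty_or_nonempty with rfl | hs
      · simp
      have : s.biUnion (fun i => (t i).disjSum (Finset.univ : Finset (Fin d)))
          = (s.biUnion t).disjSum Finset.univ := by
        obtain ⟨i, hi⟩ := hs
        ext (x | x)
        · simp
        · simpa using ⟨i, hi⟩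
      rw [this, Finset.card_disjSum, Finset.card_fin]
      exact h s
  refine ⟨Finset.univ.filter fun i => (f i).isLeft, fun i => (f i).elim id fun _ => i, ?_, ?_, ?_⟩
  · intro i hi j hj hij
    simp only [Finset.coe_filter, Finset.mem_univ, true_and, Set.mem_ofPred_eq,
      Sum.isLeft_iff] at hi hj
    obtain ⟨a, ha⟩ := hi
    obtain ⟨b, hb⟩ := hj
    refine hf ?_
    simp only [ha, hb, Sum.elim_inl, id] at hij
    rw [ha, hb, hij]
  · intro i hi
    simp only [Finset.mem_filter, Finset.mem_univ, true_and, Sum.isLeft_iff] at hi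
    obtain ⟨a, ha⟩ := hi
    have := hft i
    rw [ha] at this
    simpa [ha] using this
  · have h₁ : (Finset.univ.filter fun i => ¬ (f i).isLeft).card ≤ d := by
      have hcard : ((Finset.univ : Finset (Fin d)).map
          (Function.Embedding.inr : Fin d ↪ ι ⊕ Fin d)).card = d := by simp
      rw [← Finset.card_image_of_injective _ hf]
      refine (Finset.card_le_card fun x hx => ?_).trans hcard.le
      obtain ⟨i, hi, rfl⟩ := Finset.mem_image.1 hx
      rcases hfi : f i with a | a
      · simp [hfi] at hi
      · simp
    have h₂ := Finset.card_filter_add_card_filter_not (s := (Finset.univ : Finset ι))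
      (fun i => (f i).isLeft = true)
    rw [Finset.card_univ] at h₂
    omega

/-! ### From an invariant mean to an approximate matching -/

section TopologicalGroup

variable {G : Type*} [Group G] [TopologicalSpace G] [IsTopologicalGroup G]

theorem exists_pseudoMetricSpace_of_mem_nhds_one {U : Set G} (hU : U ∈ 𝓝 (1 : G)) :
    ∃ _ : PseudoMetricSpace G,
      (∀ δ > 0, ∃ V ∈ 𝓝 (1 : G), ∀ x y : G, y * x⁻¹ ∈ V → dist x y < δ) ∧
        ∃ r > 0, ∀ x y : G, dist x y < r → y * x⁻¹ ∈ U := by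
  let u := IsTopologicalGroup.rightUniformSpace G
  have hb := (𝓝 (1 : G)).basis_sets.comap fun p : G × G => p.2 * p.1⁻¹
  have hu : uniformity G = comap (fun p : G × G => p.2 * p.1⁻¹) (𝓝 1) :=
    uniformity_eq_comap_nhds_one' G
  rw [← hu] at hb
  obtain ⟨d, hd, hdU⟩ := exists_pseudoMetricSpace_of_mem_uniformity (hb.mem_of_mem hU)
  refine ⟨d, fun δ hδ => ?_, ?_⟩
  · obtain ⟨V, hV, h⟩ := hb.mem_iff.1 (hd (Metric.dist_mem_uniformity hδ))
    exact ⟨V, hV, fun x y hxy => h (a := (x, y)) hxy⟩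
  · obtain ⟨r, hr, h⟩ := Metric.mem_uniformity_dist.1 hdU
    exact ⟨r, hr, fun x y hxy => h hxy⟩

/-- The image of an amenable group under a bounded uniformly continuous map to a normed space can
be averaged so as to be almost invariant under finitely many translations. -/
theorem IsAmenableTopGroup.exists_norm_sum_lt (hG : IsAmenableTopGroup G) {B : Type*}
    [NormedAddCommGroup B] [NormedSpace ℝ B] (Φ : G → B) {C : ℝ} (hb : ∀ x, ‖Φ x‖ ≤ C)
    (hu : ∀ ε > 0, ∃ U ∈ 𝓝 (1 : G), ∀ x y, y * x⁻¹ ∈ U → ‖Φ y - Φ x‖ < ε)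
    (E : Finset G) {ε : ℝ} (hε : 0 < ε) :
    ∃ (ι : Type) (_ : Fintype ι) (y : ι → G), 0 < Fintype.card ι ∧
      ∀ g ∈ E, ‖∑ i, (Φ (g * y i) - Φ (y i))‖ < ε * Fintype.card ι := by
  classical
  let T : G → E → B := fun x g => Φ (g * x) - Φ x
  have key : ∃ c ∈ convexHull ℝ (Set.range T), ‖c‖ < ε := by
    -- Otherwise some functional `φ` is at least `u > 0` on all displacements `T x`. But `φ ∘ T` is
    -- a sum of differences between translates and functions in `RUCb G`, so its mean is `0` by
    -- invariance and at least `u` by positivity.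
    by_contra! hc
    obtain ⟨φ, u, hφ, hφT⟩ := geometric_hahn_banach_open (convex_ball (0 : E → B) ε)
      Metric.isOpen_ball (convex_convexHull ℝ (Set.range T)) (Set.disjoint_left.2 fun c hc₁ hc₂ =>
        (hc c hc₂).not_gt (by simpa using hc₁))
    have hu0 : 0 < u := by simpa using hφ 0 (by simpa using hε)
    let L : E → B →L[ℝ] ℝ := fun g => φ.comp (ContinuousLinearMap.single ℝ (fun _ : E => B) g)
    have hF : ∀ g, (fun x => L g (Φ x)) ∈ RUCb G := fun g => by
      refine mem_RUCb_iff.2 ⟨⟨‖L g‖ * C, fun x => ?_⟩, fun δ hδ => ?_⟩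
      · exact (L g).le_opNorm_of_le (hb x)
      · obtain ⟨U, hU, h⟩ := hu (δ / (‖L g‖ + 1)) (by positivity)
        refine ⟨U, hU, fun x y hxy => ?_⟩
        rw [← map_sub, ← Real.norm_eq_abs]
        have h₁ := h x y hxy
        rw [lt_div_iff₀ (by positivity)] at h₁
        have h₂ := (L g).le_opNorm (Φ y - Φ x)
        nlinarith [norm_nonneg (Φ y - Φ x)]
    let F : E → RUCb G := fun g => ⟨_, hF g⟩
    let F' : E → RUCb G := fun g => ⟨(F g).1 ∘ fun x => (g : G) * x,
      comp_mul_left_mem_RUCb (F g).2 g⟩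
    obtain ⟨μ, hμ₀, hμ₁, hμ⟩ := hG
    have h₁ : μ (∑ g, (F' g - F g) - u • ⟨1, one_mem_RUCb G⟩) = -u := by
      rw [map_sub, map_smul, hμ₁, map_sum, Finset.sum_eq_zero]
      · simp
      · intro g _
        rw [map_sub, sub_eq_zero]
        exact hμ g (F g)
    have h₂ := hμ₀ (∑ g, (F' g - F g) - u • ⟨1, one_mem_RUCb G⟩) fun x => by
      have h₃ : φ (T x) = ∑ g : E, (L g (Φ (g * x)) - L g (Φ x)) := by
        conv_lhs => rw [← Finset.univ_sum_single (T x), map_sum]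
        exact Finset.sum_congr rfl fun g _ => map_sub (L g) _ _
      have h₄ : u ≤ φ (T x) := hφT _ (subset_convexHull ℝ _ ⟨x, rfl⟩)
      rw [h₃] at h₄
      simpa [F, F'] using h₄
    linarith
  obtain ⟨c, hc, hcε⟩ := key
  obtain ⟨ι, hι, y, hy⟩ := exists_norm_sum_lt_of_mem_convexHull hc hcε
  refine ⟨ι, hι, y, ?_, fun g hg => ?_⟩
  · have := pos_of_mul_pos_right ((norm_nonneg _).trans_lt hy) hε.le
    exact_mod_cast this
  · refine lt_of_le_of_lt ?_ hy
    have := norm_le_pi_norm (∑ i, T (y i)) ⟨g, hg⟩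
    rwa [Finset.sum_apply] at this

/-- Almost invariance in the sup norm over all subsets `A` of `G`, applied to `A = g • y(s)`, is
Hall's condition up to deficiency `ε * card ι`. -/
theorem IsAmenableTopGroup.exists_matching (hG : IsAmenableTopGroup G) {U : Set G}
    (hU : U ∈ 𝓝 (1 : G)) (E : Finset G) {ε : ℝ} (hε : 0 < ε) :
    ∃ (ι : Type) (_ : Fintype ι) (y : ι → G), 0 < Fintype.card ι ∧
      ∀ g ∈ E, ∃ (S : Finset ι) (m : ι → ι), Set.InjOn m S ∧
        (∀ i ∈ S, y (m i) * (g * y i)⁻¹ ∈ U) ∧ (1 - ε) * Fintype.card ι ≤ S.card := by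
  classical
  obtain ⟨_, hd, r, hr, hrU⟩ := exists_pseudoMetricSpace_of_mem_nhds_one hU
  -- A bump equal to `1` on nonempty `A` and to `0` at distance at least `r` from it, Lipschitz with
  -- constant `1 / r` independent of `A`. This makes `Φ` uniformly continuous into the bounded
  -- functions on the power set.
  let f : G → Set G → ℝ := fun x A => max (1 - Metric.infDist x A / r) 0
  have hf0 : ∀ x A, 0 ≤ f x A := fun x A => le_max_right _ _
  have hf1 : ∀ x A, f x A ≤ 1 := fun x A => max_le
    (sub_le_self _ (div_nonneg Metric.infDist_nonneg hr.le)) zero_le_one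
  have hmem : ∀ x A, x ∈ A → f x A = 1 := fun x A hx => by
    simp [f, Metric.infDist_zero_of_mem hx]
  have hfabs : ∀ x A, ‖f x A‖ ≤ 1 := fun x A => by
    rw [Real.norm_of_nonneg (hf0 x A)]
    exact hf1 x A
  have hlip : ∀ x y A, |f y A - f x A| ≤ dist x y / r := fun x y A => by
    have h₁ := Metric.infDist_le_infDist_add_dist (s := A) (x := x) (y := y)
    have h₂ := Metric.infDist_le_infDist_add_dist (s := A) (x := y) (y := x)
    rw [dist_comm] at h₂
    refine (abs_max_sub_max_le_abs _ _ (0 : ℝ)).trans ?_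
    rw [sub_sub_sub_cancel_left, ← sub_div, abs_div, abs_of_pos hr]
    gcongr
    rw [abs_le]
    constructor <;> linarith
  let Φ : G → lp (fun _ : Set G => ℝ) ⊤ := fun x =>
    ⟨f x, memℓp_infty ⟨1, by rintro _ ⟨A, rfl⟩; exact hfabs x A⟩⟩
  obtain ⟨ι, hι, y, hn, hy⟩ := hG.exists_norm_sum_lt Φ (C := 1)
    (fun x => lp.norm_le_of_forall_le zero_le_one (hfabs x)) (fun δ hδ => by
      obtain ⟨V, hV, h⟩ := hd (δ / 2 * r) (by positivity)
      refine ⟨V, hV, fun x y hxy => lt_of_le_of_lt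
        (lp.norm_le_of_forall_le (half_pos hδ).le fun A => ?_) (half_lt_self hδ)⟩
      refine (hlip x y A).trans ?_
      rw [div_le_iff₀ hr]
      exact (h x y hxy).le) E hε
  refine ⟨ι, hι, y, hn, fun g hg => ?_⟩
  obtain ⟨S, m, hm, hmt, hcard⟩ := exists_partial_matching
    (fun i => Finset.univ.filter fun j => y j * (g * y i)⁻¹ ∈ U) ⌊ε * Fintype.card ι⌋₊ fun s => by
      rcases s.eq_empty_or_nonempty with rfl | hs
      · simp
      set t := s.biUnion fun i => Finset.univ.filter fun j => y j * (g * y i)⁻¹ ∈ U with ht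
      -- The bump of `A` is `1` at each `g * y i` with `i ∈ s`, and vanishes at `y j` unless `j ∈
      -- t`. Hence `s.card - t.card` is at most the change of its sum under `g`.
      let A : Set G := (fun i => g * y i) '' s
      have h₁ : (s.card : ℝ) ≤ ∑ i, f (g * y i) A := by
        rw [Finset.card_eq_sum_ones, Nat.cast_sum]
        refine (Finset.sum_le_sum fun i hi => ?_).trans
          (Finset.sum_le_univ_sum_of_nonneg fun i => hf0 _ A)
        rw [hmem _ A ⟨i, hi, rfl⟩, Nat.cast_one]
      have h₂ : ∑ i, f (y i) A ≤ t.card := by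
        rw [Finset.card_eq_sum_ones, Nat.cast_sum, ← Finset.sum_subset (Finset.subset_univ t)]
        · exact Finset.sum_le_sum fun i _ => by simpa using hf1 _ A
        · intro j _ hj
          refine max_eq_right (sub_nonpos.2 ((one_le_div hr).2 ?_))
          by_contra! hlt
          obtain ⟨_, ⟨i, hi, rfl⟩, hij⟩ := (Metric.infDist_lt_iff (hs.to_set.image _)).1 hlt
          rw [dist_comm] at hij
          exact hj (Finset.mem_biUnion.2 ⟨i, hi, by simpa using hrU _ _ hij⟩)
      have h₃ : ∑ i, f (g * y i) A - ∑ i, f (y i) A < ε * Fintype.card ι := by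
        refine lt_of_le_of_lt ?_ (hy g hg)
        have := lp.norm_apply_le_norm ENNReal.top_ne_zero (∑ i, (Φ (g * y i) - Φ (y i))) A
        rw [lp.coeFn_sum, Finset.sum_apply] at this
        refine le_trans ?_ this
        rw [← Finset.sum_sub_distrib]
        exact le_abs_self _
      rw [← Nat.sub_le_iff_le_add']
      refine Nat.le_floor ?_
      rcases le_total s.card t.card with h | h
      · rw [Nat.sub_eq_zero_of_le h]
        simpa using mul_nonneg hε.le (Nat.cast_nonneg _)
      · rw [Nat.cast_sub h]
        linarith
  refine ⟨S, m, hm, fun i hi => (Finset.mem_filter.1 (hmt i hi)).2, ?_⟩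
  have h₁ : (⌊ε * Fintype.card ι⌋₊ : ℝ) ≤ ε * Fintype.card ι := Nat.floor_le (by positivity)
  have h₂ : (Fintype.card ι : ℝ) ≤ S.card + ⌊ε * Fintype.card ι⌋₊ := by exact_mod_cast hcard
  linarith

end TopologicalGroup

/-! ### Topological Følner sets in non-discrete groups -/

section Folner

variable {G : Type*} [Group G]

/-- `F` is a finite non-empty set that is almost invariant, up to perturbation in `U` and up to a
proportion `ε` of its elements, under every `g ∈ E`, and disjoint from its translates by the
non-trivial `g ∈ E`. -/
def IsFolnerSet (U : Set G) (E : Finset G) (ε : ℝ) (F : Finset G) : Prop :=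
  F.Nonempty ∧ ∀ g ∈ E, g ≠ 1 → (∀ a ∈ F, g * a ∉ F) ∧
    ∃ (S : Finset G) (m : G → G), S ⊆ F ∧ Set.InjOn m S ∧
      (∀ a ∈ S, m a ∈ F ∧ m a * (g * a)⁻¹ ∈ U) ∧ (1 - ε) * F.card ≤ S.card

/-- Right translation commutes with left multiplication and leaves the quotients `m a * (g * a)⁻¹`
unchanged. -/
theorem IsFolnerSet.map_mulRight {U : Set G} {E : Finset G} {ε : ℝ} {F : Finset G}
    (h : IsFolnerSet U E ε F) (x : G) :
    IsFolnerSet U E ε (F.map (mulRightEmbedding x)) := by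
  refine ⟨h.1.map, fun g hg hg1 => ?_⟩
  obtain ⟨hdisj, S, m, hS, hm, hmF, hcard⟩ := h.2 g hg hg1
  refine ⟨?_, S.map (mulRightEmbedding x), fun a => m (a * x⁻¹) * x, Finset.map_subset_map.2 hS,
    ?_, ?_, by simpa using hcard⟩
  · simp only [Finset.mem_map, mulRightEmbedding_apply, forall_exists_index, and_imp]
    rintro _ a ha rfl ⟨b, hb, hab⟩
    rw [← mul_assoc, mul_left_inj] at hab
    exact hdisj a ha (hab ▸ hb)
  · rintro a ha b hb hab
    simp only [Finset.coe_map, Set.mem_image, Finset.mem_coe, mulRightEmbedding_apply] at ha hb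
    obtain ⟨a, ha, rfl⟩ := ha
    obtain ⟨b, hb, rfl⟩ := hb
    simp only [mul_inv_cancel_right, mul_left_inj] at hab
    rw [hm ha hb hab]
  · simp only [Finset.mem_map, mulRightEmbedding_apply, forall_exists_index, and_imp]
    rintro _ a ha rfl
    rw [mul_inv_cancel_right]
    refine ⟨⟨m a, (hmF a ha).1, rfl⟩, ?_⟩
    have := (hmF a ha).2
    convert this using 1
    group

/-- Points are chosen one at a time; each new one must avoid only finitely many `w` in the infinite
set `W`. -/
theorem exists_generic_perturbation {ι : Type*} {W : Set G} (hW : W.Infinite)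
    (E : Finset G) (y : ι → G) (s : Finset ι) :
    ∃ z : ι → G, (∀ i ∈ s, ∃ w ∈ W, z i = w * y i) ∧
      ∀ i ∈ s, ∀ j ∈ s, i ≠ j → ∀ g ∈ E, g * z i ≠ z j := by
  classical
  induction s using Finset.induction_on with
  | empty => exact ⟨y, by simp, by simp⟩
  | insert a s ha ih =>
    obtain ⟨z, hz, hzE⟩ := ih
    let bad : Finset G := (s ×ˢ E).image (fun p => p.2⁻¹ * z p.1 * (y a)⁻¹) ∪
      (s ×ˢ E).image (fun p => p.2 * z p.1 * (y a)⁻¹)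
    obtain ⟨w, hw, hwbad⟩ := hW.exists_notMem_finset bad
    have h₁ : ∀ i ∈ s, ∀ g ∈ E, g * (w * y a) ≠ z i := fun i hi g hg h => hwbad <|
      Finset.mem_union_left _ <| Finset.mem_image.2 ⟨(i, g), Finset.mk_mem_product hi hg, by
        simp [← h, mul_assoc]⟩
    have h₂ : ∀ i ∈ s, ∀ g ∈ E, g * z i ≠ w * y a := fun i hi g hg h => hwbad <|
      Finset.mem_union_right _ <| Finset.mem_image.2 ⟨(i, g), Finset.mk_mem_product hi hg, by
        simp [h, mul_assoc]⟩
    have hne : ∀ i ∈ s, i ≠ a := fun i hi h => ha (h ▸ hi)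
    refine ⟨Function.update z a (w * y a), fun i hi => ?_, fun i hi j hj hij g hg => ?_⟩
    · rcases Finset.mem_insert.1 hi with rfl | hi
      · exact ⟨w, hw, by simp⟩
      · simpa [hne i hi] using hz i hi
    · rcases Finset.mem_insert.1 hi with rfl | hi' <;> rcases Finset.mem_insert.1 hj with rfl | hj'
      · exact absurd rfl hij
      · simpa [hne j hj'] using h₁ j hj' g hg
      · simpa [hne i hi'] using h₂ i hi' g hg
      · simpa [hne i hi', hne j hj'] using hzE i hi' j hj' hij g hg

variable [TopologicalSpace G] [IsTopologicalGroup G] [T2Space G]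

theorem IsAmenableTopGroup.exists_isFolnerSet (hG : IsAmenableTopGroup G) [(𝓝[≠] (1 : G)).NeBot]
    {U : Set G} (hU : U ∈ 𝓝 (1 : G)) (E : Finset G) {ε : ℝ} (hε : 0 < ε) :
    ∃ F : Finset G, IsFolnerSet U E ε F := by
  classical
  obtain ⟨V₁, hV₁, hV₁U⟩ := exists_nhds_one_split hU
  obtain ⟨V, hV, hVV₁⟩ := exists_nhds_one_split hV₁
  have hVU : ∀ a ∈ V, ∀ b ∈ V, ∀ c ∈ V, a * b * c ∈ U := fun a ha b hb c hc =>
    hV₁U _ (hVV₁ a ha b hb) _ (by simpa using hVV₁ c hc 1 (mem_of_mem_nhds hV))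
  -- For `z i = w * y i` and `z j = w' * y j`, the quotient `z j * (g * z i)⁻¹` is `w' * (y j * (g *
  -- y i)⁻¹) * (g * w⁻¹ * g⁻¹)`; this neighbourhood puts the outer factors in `V`.
  have hW : V ∩ ⋂ g ∈ E, {w : G | g * w⁻¹ * g⁻¹ ∈ V} ∈ 𝓝 (1 : G) := by
    refine inter_mem hV ((biInter_finset_mem E).2 fun g _ => ?_)
    have hc : Continuous fun w : G => g * w⁻¹ * g⁻¹ := by fun_prop
    exact hc.continuousAt.preimage_mem_nhds (by simpa using hV)
  obtain ⟨ι, _, y, hι, hy⟩ := hG.exists_matching hV E hε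
  -- Including `1` makes the perturbed points distinct.
  obtain ⟨z, hz, hzE⟩ := exists_generic_perturbation (infinite_of_mem_nhds 1 hW)
    (insert 1 E) y Finset.univ
  have hinj : Function.Injective z := fun i j hij => by
    by_contra hne
    exact hzE i (Finset.mem_univ _) j (Finset.mem_univ _) hne 1 (Finset.mem_insert_self _ _)
      (by rwa [one_mul])
  have : Nonempty ι := Fintype.card_pos_iff.1 hι
  refine ⟨Finset.univ.map ⟨z, hinj⟩, Finset.univ_nonempty.map, fun g hg hg1 => ⟨?_, ?_⟩⟩
  · simp only [Finset.mem_map, Finset.mem_univ, true_and, Function.Embedding.coeFn_mk,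
      forall_exists_index, forall_apply_eq_imp_iff, not_exists]
    intro i j hij
    rcases eq_or_ne i j with rfl | hne
    · exact hg1 (by simpa using hij.symm)
    · exact hzE i (Finset.mem_univ _) j (Finset.mem_univ _) hne g (Finset.mem_insert_of_mem hg)
        hij.symm
  · obtain ⟨S, m, hm, hmV, hcard⟩ := hy g hg
    refine ⟨S.map ⟨z, hinj⟩, Function.extend z (z ∘ m) id,
      Finset.map_subset_map.2 (Finset.subset_univ S), ?_, ?_, by simpa using hcard⟩
    · rintro a ha b hb hab
      simp only [Finset.coe_map, Set.mem_image, Finset.mem_coe,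
        Function.Embedding.coeFn_mk] at ha hb
      obtain ⟨i, hi, rfl⟩ := ha
      obtain ⟨j, hj, rfl⟩ := hb
      rw [hinj.extend_apply, hinj.extend_apply] at hab
      rw [hm hi hj (hinj hab)]
    · simp only [Finset.mem_map, Function.Embedding.coeFn_mk, forall_exists_index, and_imp]
      rintro _ i hi rfl
      rw [hinj.extend_apply]
      refine ⟨⟨m i, Finset.mem_univ _, rfl⟩, ?_⟩
      obtain ⟨w, hw, hwi⟩ := hz i (Finset.mem_univ _)
      obtain ⟨w', hw', hwi'⟩ := hz (m i) (Finset.mem_univ _)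
      have := hVU w' hw'.1 _ (hmV i hi) (g * w⁻¹ * g⁻¹) (Set.mem_iInter₂.1 hw.2 g hg)
      convert this using 1
      rw [Function.comp_apply, hwi, hwi']
      group

end Folner

/-! ### Disjoint translates and the perturbed translations -/

open Cardinal in
-- Transfinite recursion along the initial ordinal of `#G`: at each stage fewer than `#G` indices
-- came before, each excluding finitely many values, so an admissible translate remains.
theorem exists_pairwise_disjoint_translates {G I : Type*} [Group G] [Infinite G] (e : I ≃ G)
    (K : I → Finset G) :
    ∃ x : I → G, ∀ i j, i ≠ j → ∀ a ∈ K i, ∀ b ∈ K j, a * x i ≠ b * x j := by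
  let T := (#G).ord.ToType
  have hT : ∀ t : T, #(Set.Iio t) < #G := fun t => by
    simpa [T] using mk_Iio_lt t (by simp [T])
  obtain ⟨eT⟩ : Nonempty (T ≃ G) := Cardinal.eq.1 (by simp [T])
  let k : T → Finset G := fun t => K (e.symm (eT t))
  have hex : ∀ (t : T) (x : T → G), ∃ z : G, ∀ s < t, ∀ a ∈ k t, ∀ b ∈ k s, a * z ≠ b * x s := by
    intro t x
    by_contra! hbad
    let f : (Σ s : Set.Iio t, k t × k s) → G := fun p => (p.2.1 : G)⁻¹ * (p.2.2 * x p.1)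
    have hf : Function.Surjective f := fun z => by
      obtain ⟨s, hs, a, ha, b, hb, h⟩ := hbad z
      exact ⟨⟨⟨s, hs⟩, ⟨a, ha⟩, ⟨b, hb⟩⟩, by simp [f, ← h]⟩
    have hle : #G ≤ #(Σ s : Set.Iio t, k t × k s) := mk_le_of_surjective hf
    rcases finite_or_infinite (Set.Iio t) with hfin | hinf
    · exact not_finite_iff_infinite.2 ‹Infinite G› (Finite.of_surjective f hf)
    · have h₁ : #(Σ s : Set.Iio t, k t × k s) ≤ #(Set.Iio t) * ℵ₀ := by
        rw [mk_sigma]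
        refine (sum_le_sum _ (fun _ => ℵ₀) fun s => ?_).trans (by simp)
        exact mk_le_aleph0
      rw [mul_aleph0_eq (aleph0_le_mk _)] at h₁
      exact (hle.trans h₁).not_gt (hT t)
  choose z hz using hex
  -- The value `1` at indices not below `t` is never consulted.
  let x : T → G := wellFounded_lt.fix fun t prev => z t fun s => if h : s < t then prev s h else 1
  have hx : ∀ t, x t = z t fun s => if s < t then x s else 1 := fun t => wellFounded_lt.fix_eq _ t
  have hlt : ∀ s t, s < t → ∀ a ∈ k t, ∀ b ∈ k s, a * x t ≠ b * x s := fun s t hst a ha b hb => by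
    have := hz t (fun s => if s < t then x s else 1) s hst a ha b hb
    rwa [← hx, if_pos hst] at this
  refine ⟨fun i => x (eT.symm (e i)), fun i j hij a ha b hb => ?_⟩
  have hk : ∀ i, k (eT.symm (e i)) = K i := fun i => by simp [k]
  rcases lt_or_gt_of_ne fun h => hij (e.injective (eT.symm.injective h)) with h | h
  · exact (hlt _ _ h b (by rwa [hk]) a (by rwa [hk])).symm
  · exact hlt _ _ h a (by rwa [hk]) b (by rwa [hk])

theorem exists_involution_of_injective {P X : Type*} {f : P ⊕ P → X} (hf : Function.Injective f) :
    ∃ σ : Equiv.Perm X, (∀ p, σ (f (Sum.inl p)) = f (Sum.inr p)) ∧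
      (∀ p, σ (f (Sum.inr p)) = f (Sum.inl p)) ∧ ∀ x ∉ Set.range f, σ x = x := by
  classical
  refine ⟨Equiv.Perm.extendDomain (Equiv.sumComm P P) (Equiv.ofInjective f hf), fun p => ?_, fun p => ?_,
    fun x hx => Equiv.Perm.extendDomain_apply_not_subtype _ _ hx⟩
  · exact Equiv.Perm.extendDomain_apply_image (Equiv.sumComm P P) (Equiv.ofInjective f hf) _
  · exact Equiv.Perm.extendDomain_apply_image (Equiv.sumComm P P) (Equiv.ofInjective f hf) _

/-- The mean `f ↦ |F|⁻¹ ∑_{x ∈ F} f x`. -/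
noncomputable def averageMean {X : Type*} (F : Finset X) : ellInfty X →ₗ[ℝ] ℝ where
  toFun f := (F.card : ℝ)⁻¹ * ∑ x ∈ F, f.1 x
  map_add' f g := by simp [Finset.sum_add_distrib, mul_add]
  map_smul' c f := by simp [← Finset.mul_sum, mul_left_comm]

theorem isMean_averageMean {X : Type*} {F : Finset X} (hF : F.Nonempty) :
    IsMean (averageMean F) where
  nonneg _ hf := mul_nonneg (by positivity) (Finset.sum_nonneg fun x _ => hf x)
  map_one _ := by
    have : (F.card : ℝ) ≠ 0 := by exact_mod_cast hF.card_pos.ne'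
    simp [averageMean, this]

/-- The sums over `F` and its image under `τ` cancel on the intersection; the two differences have
equal cardinality, at most `ε * F.card`. -/
theorem abs_averageMean_comp_sub_le {X : Type*} [DecidableEq X] {F : Finset X} (hF : F.Nonempty)
    (τ : Equiv.Perm X) {ε : ℝ} (hτ : ((F.filter fun x => τ x ∉ F).card : ℝ) ≤ ε * F.card)
    (f : ellInfty X) {C : ℝ} (hC : ∀ x, |f.1 x| ≤ C) :
    |averageMean F ⟨f.1 ∘ τ, comp_mem_ellInfty f.2 _⟩ - averageMean F f| ≤ 2 * C * ε := by
  have hF0 : (0 : ℝ) < F.card := by exact_mod_cast hF.card_pos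
  let F' := F.map τ.toEmbedding
  have hC0 : 0 ≤ C := (abs_nonneg _).trans (hC hF.choose)
  have hc₁ : (F' \ F).card = (F.filter fun x => τ x ∉ F).card := by
    rw [← Finset.card_map (s := F.filter fun x => τ x ∉ F) τ.toEmbedding]
    congr 1
    ext x
    simp only [F', Finset.mem_sdiff, Finset.mem_map, Finset.mem_filter]
    constructor
    · rintro ⟨⟨a, ha, rfl⟩, hx⟩
      exact ⟨a, ⟨ha, hx⟩, rfl⟩
    · rintro ⟨a, ⟨ha, hx⟩, rfl⟩
      exact ⟨⟨a, ha, rfl⟩, hx⟩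
  have hc₂ : (F \ F').card = (F' \ F).card := Finset.card_sdiff_comm (by simp [F'])
  have hsum : ∀ A : Finset X, |∑ x ∈ A, f.1 x| ≤ A.card * C := fun A =>
    (Finset.abs_sum_le_sum_abs _ _).trans <| by
      simpa using Finset.sum_le_card_nsmul A _ C fun x _ => hC x
  have hmap : ∑ x ∈ F, f.1 (τ x) = ∑ x ∈ F', f.1 x := by simp [F']
  change |(F.card : ℝ)⁻¹ * ∑ x ∈ F, f.1 (τ x) - (F.card : ℝ)⁻¹ * ∑ x ∈ F, f.1 x| ≤ _
  rw [← mul_sub, abs_mul, abs_of_pos (inv_pos.2 hF0), hmap, ← Finset.sum_sdiff_sub_sum_sdiff,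
    inv_mul_le_iff₀ hF0]
  refine (abs_sub _ _).trans ((add_le_add (hsum _) (hsum _)).trans ?_)
  rw [hc₂, hc₁]
  nlinarith

/-- A family of Følner sets whose members and translates are pairwise disjoint yields, for every
`g`, a perturbation of the left translation by `g` under which all these sets are almost
invariant. -/
theorem exists_perturbed_translation {G I : Type*} [Group G] [DecidableEq G] {U : Set G}
    (h1 : (1 : G) ∈ U) (hinv : ∀ u ∈ U, u⁻¹ ∈ U) (E : I → Finset G) (ε : I → ℝ) (hε : ∀ i, 0 ≤ ε i)
    (F : I → Finset G) (hF : ∀ i, IsFolnerSet U (E i) (ε i) (F i))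
    (hdisj : ∀ i j, i ≠ j → ∀ a ∈ F i, ∀ b ∈ F j, a ≠ b)
    (hdisjE : ∀ i j, i ≠ j → ∀ g ∈ E i, ∀ a ∈ F i, ∀ b ∈ F j, a ≠ g * b) (g : G) :
    ∃ τ : Equiv.Perm G, (∀ h, ∃ u ∈ U, τ h = u * (g * h)) ∧
      ∀ i, g ∈ E i → (((F i).filter fun x => τ x ∉ F i).card : ℝ) ≤ ε i * (F i).card := by
  rcases eq_or_ne g 1 with rfl | hg1
  · refine ⟨1, fun h => ⟨1, h1, by simp⟩, fun i _ => ?_⟩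
    rw [Finset.filter_eq_empty_iff.2 (by simp)]
    simpa using mul_nonneg (hε i) (Nat.cast_nonneg _)
  choose hgF S m hS hm hmF hcard using fun i (hi : g ∈ E i) => (hF i).2 g hi hg1
  let P := Σ i : {i // g ∈ E i}, S i.1 i.2
  -- The involution `σ` swaps `a` with `g⁻¹ * m a`, so `g * σ` sends `a` to `m a` and `g⁻¹ * m a` to
  -- `g * a`. The second move has the inverse error of the first, whence the symmetry of `U`.
  -- Disjointness of the sets and their translates makes all swapped points distinct.
  let f : P ⊕ P → G := Sum.elim (fun p => p.2.1) fun p => g⁻¹ * m p.1.1 p.1.2 p.2.1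
  have hPF : ∀ p : P, p.2.1 ∈ F p.1.1 := fun p => hS _ _ p.2.2
  have hPm : ∀ p : P, m p.1.1 p.1.2 p.2.1 ∈ F p.1.1 := fun p => (hmF _ _ _ p.2.2).1
  have hf : Function.Injective f := by
    refine Function.Injective.sumElim ?_ ?_ ?_
    · rintro ⟨⟨i, hi⟩, a⟩ ⟨⟨j, hj⟩, b⟩ hab
      obtain rfl : i = j := by
        by_contra hij
        exact hdisj i j hij _ (hPF ⟨⟨i, hi⟩, a⟩) _ (hPF ⟨⟨j, hj⟩, b⟩) hab
      obtain rfl : a = b := Subtype.ext hab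
      rfl
    · rintro ⟨⟨i, hi⟩, a⟩ ⟨⟨j, hj⟩, b⟩ hab
      have hab' := mul_left_cancel hab
      obtain rfl : i = j := by
        by_contra hij
        exact hdisj i j hij _ (hPm ⟨⟨i, hi⟩, a⟩) _ (hPm ⟨⟨j, hj⟩, b⟩) hab'
      obtain rfl : a = b := Subtype.ext (hm i hi a.2 b.2 hab')
      rfl
    · rintro p q hpq
      have hpq' : m q.1.1 q.1.2 q.2.1 = g * p.2.1 := by rw [hpq, mul_inv_cancel_left]
      by_cases hij : q.1.1 = p.1.1
      · exact hgF _ p.1.2 _ (hPF p) (by rw [← hpq', ← hij]; exact hPm q)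
      · exact hdisjE _ _ hij g q.1.2 _ (hPm q) _ (hPF p) hpq'
  obtain ⟨σ, hσ₁, hσ₂, hσ₃⟩ := exists_involution_of_injective hf
  refine ⟨Equiv.mulLeft g * σ, fun h => ?_, fun i hi => ?_⟩
  · simp only [Equiv.Perm.mul_apply, Equiv.coe_mulLeft]
    by_cases hh : h ∈ Set.range f
    · obtain ⟨p | p, rfl⟩ := hh
      · refine ⟨_, (hmF _ _ _ p.2.2).2, ?_⟩
        rw [hσ₁]
        exact (mul_inv_cancel_left g _).trans (inv_mul_cancel_right _ _).symm
      · refine ⟨_, hinv _ (hmF _ _ _ p.2.2).2, ?_⟩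
        rw [hσ₂]
        simp [f]
    · exact ⟨1, h1, by rw [hσ₃ h hh, one_mul]⟩
  · have hsub : ((F i).filter fun x => (Equiv.mulLeft g * σ) x ∉ F i) ⊆ F i \ S i hi := by
      intro x hx
      rw [Finset.mem_filter] at hx
      refine Finset.mem_sdiff.2 ⟨hx.1, fun hxS => hx.2 ?_⟩
      have h := hσ₁ ⟨⟨i, hi⟩, ⟨x, hxS⟩⟩
      simp only [f, Sum.elim_inl, Sum.elim_inr] at h
      rw [Equiv.Perm.mul_apply, h, Equiv.coe_mulLeft]
      beta_reduce
      rw [mul_inv_cancel_left]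
      exact (hmF i hi x hxS).1
    have h₁ := Finset.card_le_card hsub
    have h₂ := Finset.card_sdiff_add_card_eq_card (hS i hi)
    have h₃ : (((F i).filter fun x => (Equiv.mulLeft g * σ) x ∉ F i).card : ℝ) + (S i hi).card
        ≤ (F i).card := by
      exact_mod_cast (Nat.add_le_add_right h₁ _).trans h₂.le
    linarith [hcard i hi]

theorem IsAmenableTopGroup.exists_amenable_perturbation {G : Type*} [Group G] [TopologicalSpace G]
    [IsTopologicalGroup G] [T2Space G] (hG : IsAmenableTopGroup G) [(𝓝[≠] (1 : G)).NeBot]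
    {U : Set G} (hU : U ∈ 𝓝 (1 : G)) :
    ∃ α ∈ perturbations U, IsAmenableAction (generatedGroup α) G := by
  classical
  have hU' : U ∩ U⁻¹ ∈ 𝓝 (1 : G) := inter_mem hU (inv_mem_nhds_one G hU)
  have hinf : Infinite G :=
    Set.infinite_univ_iff.1 (infinite_of_mem_nhds (1 : G) univ_mem)
  let ε : Finset G × ℕ → ℝ := fun i => 1 / ((i.2 : ℝ) + 1)
  have hε : ∀ i, 0 < ε i := fun i => by positivity
  choose F₀ hF₀ using fun i : Finset G × ℕ => hG.exists_isFolnerSet hU' i.1 (hε i)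
  obtain ⟨e⟩ : Nonempty (Finset G × ℕ ≃ G) := Cardinal.eq.1 (by simp)
  -- Adjoining the sets `g⁻¹ * F₀ i` for `g ∈ i.1` also separates `F i` from `g * F j`.
  obtain ⟨x, hx⟩ := exists_pairwise_disjoint_translates e fun i =>
    F₀ i ∪ (i.1 ×ˢ F₀ i).image fun p => p.1⁻¹ * p.2
  let F : Finset G × ℕ → Finset G := fun i => (F₀ i).map (mulRightEmbedding (x i))
  have hF : ∀ i, IsFolnerSet (U ∩ U⁻¹) i.1 (ε i) (F i) := fun i => (hF₀ i).map_mulRight _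
  choose α hαU hα using exists_perturbed_translation (mem_of_mem_nhds hU')
    (fun u hu => ⟨hu.2, by simpa using hu.1⟩) Prod.fst ε (fun i => (hε i).le) F hF
    (fun i j hij a ha b hb hab => by
      obtain ⟨a, ha', rfl⟩ := Finset.mem_map.1 ha
      obtain ⟨b, hb', rfl⟩ := Finset.mem_map.1 hb
      exact hx i j hij a (Finset.mem_union_left _ ha') b (Finset.mem_union_left _ hb') hab)
    (fun i j hij g hg a ha b hb hab => by
      obtain ⟨a, ha', rfl⟩ := Finset.mem_map.1 ha
      obtain ⟨b, hb', rfl⟩ := Finset.mem_map.1 hb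
      refine hx i j hij (g⁻¹ * a) (Finset.mem_union_right _ (Finset.mem_image.2
        ⟨(g, a), Finset.mk_mem_product hg ha', rfl⟩)) b (Finset.mem_union_left _ hb') ?_
      rw [mul_assoc, inv_mul_eq_iff_eq_mul]
      exact hab)
  refine ⟨α, fun g h => ?_, ?_⟩
  · obtain ⟨u, hu, h⟩ := hαU g h
    exact ⟨u, hu.1, h⟩
  obtain ⟨μ, hμ, hlim⟩ := exists_limit_mean le_rfl (one_mem_ellInfty G)
    (atTop : Filter (Finset G × ℕ)) (fun i => averageMean (F i))
    fun i => isMean_averageMean (hF i).1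
  refine isAmenableAction_generatedGroup hμ fun g f => hlim _ _ ?_
  obtain ⟨C, hC⟩ := f.2
  have hε0 : Tendsto ε atTop (𝓝 0) := by
    rw [← prod_atTop_atTop_eq]
    exact tendsto_one_div_add_atTop_nhds_zero_nat.comp tendsto_snd
  refine squeeze_zero_norm' ?_ (by simpa using hε0.const_mul (2 * C))
  -- From this index on, `g` belongs to `i.1`, so the estimate for `α g` applies.
  filter_upwards [eventually_ge_atTop (({g}, 0) : Finset G × ℕ)] with i hi
  exact abs_averageMean_comp_sub_le (hF i).1 (α g)
    (hα g i (Finset.singleton_subset_iff.1 hi.1)) f hC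

theorem theorem5p3 (G : Type*) [Group G] [TopologicalSpace G] [IsTopologicalGroup G] [T2Space G] :
    List.TFAE [
      IsAmenableTopGroup G,
      ∀ U ∈ 𝓝 (1 : G), ∃ α ∈ perturbations U, IsAmenableAction (generatedGroup α) G,
      ∀ U ∈ 𝓝 (1 : G), IsAmenableAction (perturbationGroup U) (G × perturbations U)] := by
  tfae_have 1 → 2 := fun hG U hU => by
    rcases (𝓝[≠] (1 : G)).eq_or_neBot with h | h
    · refine ⟨fun g => Equiv.mulLeft g, fun g h => ⟨1, mem_of_mem_nhds hU, by simp⟩,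
        isAmenableAction_mulLeft_of_discrete ?_ hG⟩
      exact (isOpen_singleton_iff_punctured_nhds 1).2 h |>.mem_nhds rfl
    · exact hG.exists_amenable_perturbation hU
  tfae_have 2 → 3 := fun h U hU => by
    obtain ⟨α, hα, hamen⟩ := h U hU
    exact isAmenableAction_directSumPerm _ (⟨α, hα⟩ : perturbations U) hamen
  tfae_have 3 → 1 := isAmenableTopGroup_of_perturbationGroup
  tfae_finish
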